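/- Let $b:\mathbb{R}^n\to\mathbb{R}^n$, let $\hat{x}:[0,\infty)\to\mathbb{R}^n$ solve $\hat{x}'(t)=b(\hat{x}(t))$, assume that $b$ is differentiable at $\hat{x}(t)$ for every $t\ge 0$, and let $A(\hat{x}(t))$ be the Jacobian matrix of $b$ at $\hat{x}(t)$. Let $D$ be a constant symmetric positive semidefinite $n\times n$ matrix, let $(2D)^{1/2}$ be the positive semidefinite square root of $2D$, and let $B$ be a standard $n$-dimensional Brownian motion. Let $Z$ be a continuous solution of the linearised stochastic differential equation $$dZ(t)=A(\hat{x}(t))\,Z(t)\,dt+(2D)^{1/2}\,dB(t),\qquad t\ge 0,$$ that is, almost surely $Z(t)=Z(0)+\int_0^t A(\hat{x}(s))Z(s)\,ds+(2D)^{1/2}(B(t)-B(0))$ for all $t\ge0$, whose initial value $Z(0)$ is independent of $B$ and has the (possibly degenerate) Gaussian law $\mathcal{N}(\mu_0,\Sigma_0)$, where $\mu_0\in\mathbb{R}^n$ and $\Sigma_0$ is symmetric positive semidefinite; a deterministic initial value is the case $\Sigma_0=0$. If every entry of $A(\hat{x}(t))$ is continuous in $t\ge 0$, then for every $t\ge 0$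 the random vector $Z(t)$ is (possibly degenerate) multivariate Gaussian, $Z(t)\sim\mathcal{N}(\mu(t),\Sigma(t))$, where its mean $\mu(t)=\mathbb{E}[Z(t)]$ and its covariance matrix $\Sigma(t)=\mathrm{Cov}(Z(t))$ are differentiable in $t\ge0$ (one-sidedly at $t=0$) and satisfy $$\mu'(t)=A(\hat{x}(t))\,\mu(t),\qquad \mu(0)=\mu_0,$$ $$\Sigma'(t)=A(\hat{x}(t))\,\Sigma(t)+\Sigma(t)\,A(\hat{x}(t))^{T}+2D,\qquad \Sigma(0)=\Sigma_0 .$$ -/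

import Mathlib

open MeasureTheory ProbabilityTheory Set
open scoped NNReal

/-- The Jacobian matrix `(∂bᵢ/∂xⱼ)(x)` of a vector field `b` on `ℝⁿ`. -/
noncomputable def jacobianMatrix {n : ℕ}
    (b : EuclideanSpace ℝ (Fin n) → EuclideanSpace ℝ (Fin n)) (x : EuclideanSpace ℝ (Fin n)) :
    Matrix (Fin n) (Fin n) ℝ :=
  Matrix.of fun i j => (fderiv ℝ b x (EuclideanSpace.single j 1)) i

open scoped MatrixOrder in
/-- The positive semidefinite square root `S^{1/2}` of a positive semidefinite real matrix `S`. -/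
noncomputable def psdSqrt {n : ℕ} (S : Matrix (Fin n) (Fin n) ℝ) : Matrix (Fin n) (Fin n) ℝ :=
  CFC.sqrt S

/-- `psdSqrt` is a square root. -/
theorem psdSqrt_mul_self {n : ℕ} {S : Matrix (Fin n) (Fin n) ℝ} (hS : S.PosSemidef) :
    psdSqrt S * psdSqrt S = S := by
  open scoped MatrixOrder in
  exact CFC.sqrt_mul_sqrt_self S hS.nonneg

/-- `psdSqrt` is positive semidefinite. -/
theorem psdSqrt_posSemidef {n : ℕ} (S : Matrix (Fin n) (Fin n) ℝ) : (psdSqrt S).PosSemidef := by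
  open scoped MatrixOrder in
  exact Matrix.nonneg_iff_posSemidef.1 (CFC.sqrt_nonneg S)

/-- Standard `n`-dimensional Brownian motion: the coordinates are independent standard
real Brownian motions. -/
structure IsStdBrownianMotion {n : ℕ} {Ω : Type*} [MeasurableSpace Ω]
    (B : ℝ≥0 → Ω → EuclideanSpace ℝ (Fin n)) (P : Measure Ω) : Prop where
  measurable : ∀ t, Measurable (B t)
  isBrownianReal : ∀ i, IsBrownianReal (fun t ω => B t ω i) P
  iIndepFun : iIndepFun (fun (i : Fin n) (ω : Ω) (t : ℝ≥0) => B t ω i) P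

/-- `Z` is a (pathwise continuous) solution of the linear stochastic differential equation
`dZ = A(t) Z dt + σ dB` with constant noise matrix `σ`, that is, almost surely, for all `t ≥ 0`,
`Z(t) = Z(0) + ∫₀ᵗ A(s) Z(s) ds + σ (B(t) - B(0))`. As `σ` is constant, the Itô integral
`∫₀ᵗ σ dB` is `σ (B(t) - B(0))`. -/
structure IsLinearSDESolution {n : ℕ} {Ω : Type*} [MeasurableSpace Ω]
    (A : ℝ → Matrix (Fin n) (Fin n) ℝ) (σ : Matrix (Fin n) (Fin n) ℝ)
    (B Z : ℝ≥0 → Ω → EuclideanSpace ℝ (Fin n)) (P : Measure Ω) : Prop where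
  measurable : ∀ t, Measurable (Z t)
  continuous_paths : ∀ᵐ ω ∂P, Continuous fun t => Z t ω
  integral_eq : ∀ᵐ ω ∂P, ∀ t : ℝ≥0,
    Z t ω = Z 0 ω
      + (∫ s in (0 : ℝ)..t, Matrix.toEuclideanCLM (𝕜 := ℝ) (A s) (Z s.toNNReal ω))
      + Matrix.toEuclideanCLM (𝕜 := ℝ) σ (B t ω - B 0 ω)

/-- The mean `𝔼[X]` of a random vector. -/
noncomputable def meanVector {n : ℕ} {Ω : Type*} [MeasurableSpace Ω]
    (X : Ω → EuclideanSpace ℝ (Fin n)) (P : Measure Ω) : EuclideanSpace ℝ (Fin n) :=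
  ∫ ω, X ω ∂P

/-- The covariance matrix `(Cov(Xᵢ, Xⱼ))` of a random vector. -/
noncomputable def covarianceMatrix {n : ℕ} {Ω : Type*} [MeasurableSpace Ω]
    (X : Ω → EuclideanSpace ℝ (Fin n)) (P : Measure Ω) : Matrix (Fin n) (Fin n) ℝ :=
  Matrix.of fun i j => cov[fun ω => X ω i, fun ω => X ω j; P]

/-!
Write `W = σ B` with `σ = (2D)^{1/2}`, so that `σ σᵀ = 2D`. The stochastic differential
equation is read as an integral equation in the Hilbert space `L²(P)`, where no stochastic calculus
and no fundamental matrix are needed.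

The pathwise form of Grönwall's inequality `norm_le_of_linear_integral_eq` bounds `‖Z t‖` by
`‖Z 0‖`, `‖W t‖` and the time integral of `‖W‖`, so `Z` has second moments, bounded on bounded time
intervals. Fubini's theorem then gives, for every `v ∈ L²(P)`, an integral equation for `E[v Z t]`,
and this weak form upgrades to the Bochner integral equation `IsLinearIntegralSolution` for the
coordinates of `Z`, as elements of `L²(P)`
(`IsLinearSDESolution.exists_isLinearIntegralSolution`).

If `v` is orthogonal to `Z 0` and to `W s` for all `s ≤ T`, its inner products with `Z` solve a
homogeneous linear equation with zero initial value, hence `v` is orthogonal to `Z t` for `t ≤ T`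
(`IsLinearIntegralSolution.inner_eq_zero`). This has two consequences. First, the coordinates of
`Z t` lie in the closed linear span of those of `Z 0` and of the `W s`. These are jointly Gaussian
by independence, and `L²` limits of Gaussian variables are Gaussian, so `Z t` is Gaussian. Second,
taking for `v` an increment of `W` after time `s`, such an increment is uncorrelated with `Z s`.

The equation for the mean is the inner product of the `L²` equation with the constant `1`. For the
covariance, `Z - W` is differentiable in `L²` with derivative `A Z`. Expanding `Z = (Z - W) + W` in
`⟪Z i, Z j⟫`, the term `⟪W i, W j⟫` is `2 D i j t`, and by the second consequence the cross term
`⟪Z i - W i, W j⟫` is the integral of `∑ k, A i k ⟪Z k, W j⟫` with both factors at the same time.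
The derivatives add up to the Lyapunov equation
(`IsLinearIntegralSolution.hasDerivWithinAt_inner`).
-/

/-! ### Linear integral equations in a Hilbert space -/

/-- The functions `z i : ℝ → H` solve the linear integral equation
`z i t = z i 0 + ∫₀ᵗ ∑ j, A i j (s) z j (s) ds + w i t` for `t ≥ 0`, with additive noise `w`. -/
structure IsLinearIntegralSolution {ι H : Type*} [Fintype ι] [NormedAddCommGroup H]
    [InnerProductSpace ℝ H] (A : ℝ → Matrix ι ι ℝ) (z w : ι → ℝ → H) : Prop where
  continuous_coeff : ∀ i j, Continuous fun t => A t i j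
  continuous : ∀ i, Continuous (z i)
  continuous_noise : ∀ i, Continuous (w i)
  integral_eq : ∀ i, ∀ t, 0 ≤ t →
    z i t = z i 0 + (∫ s in (0 : ℝ)..t, ∑ j, A s i j • z j s) + w i t

namespace IsLinearIntegralSolution

open scoped InnerProductSpace

variable {ι H : Type*} [Fintype ι] [NormedAddCommGroup H] [InnerProductSpace ℝ H]
  {A : ℝ → Matrix ι ι ℝ} {z w : ι → ℝ → H}

lemma continuous_drift (h : IsLinearIntegralSolution A z w) (i : ι) :
    Continuous fun s => ∑ j, A s i j • z j s :=
  continuous_finsetSum _ fun j _ => (h.continuous_coeff i j).smul (h.continuous j)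

lemma noise_zero (h : IsLinearIntegralSolution A z w) (i : ι) : w i 0 = 0 := by
  simpa using h.integral_eq i 0 le_rfl

variable [CompleteSpace H]

lemma hasDerivWithinAt_sub_noise (h : IsLinearIntegralSolution A z w) (i : ι) {t : ℝ}
    (ht : 0 ≤ t) :
    HasDerivWithinAt (fun s => z i s - w i s) (∑ j, A t i j • z j t) (Ici 0) t := by
  have h1 : HasDerivAt (fun s => z i 0 + ∫ r in (0 : ℝ)..s, ∑ j, A r i j • z j r)
      (∑ j, A t i j • z j t) t :=
    ((h.continuous_drift i).integral_hasStrictDerivAt 0 t).hasDerivAt.const_add _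
  refine h1.hasDerivWithinAt.congr (fun s hs => ?_) ?_
  · rw [h.integral_eq i s hs]; abel
  · rw [h.integral_eq i t ht]; abel

/-- A vector orthogonal to the initial values and to the noise up to time `T` is orthogonal to the
solution up to time `T`: its inner products with the solution solve a homogeneous linear equation
with zero initial value. -/
lemma inner_eq_zero (h : IsLinearIntegralSolution A z w) {v : H} {T : ℝ}
    (h0 : ∀ i, ⟪v, z i 0⟫_ℝ = 0) (hw : ∀ i, ∀ s ∈ Icc 0 T, ⟪v, w i s⟫_ℝ = 0) (i : ι) {t : ℝ}
    (ht : t ∈ Icc 0 T) : ⟪v, z i t⟫_ℝ = 0 := by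
  let f : ℝ → ι → ℝ := fun t i => ⟪v, z i t - w i t⟫_ℝ
  have hf : ∀ t ∈ Icc 0 T, ∀ i, f t i = ⟪v, z i t⟫_ℝ := fun t ht i => by
    simp [f, inner_sub_right, hw i t ht]
  have hder : ∀ t ∈ Icc 0 T, HasDerivWithinAt f (fun i => ∑ j, A t i j * f t j) (Ici 0) t := by
    intro t ht
    rw [hasDerivWithinAt_pi]
    intro i
    have := (hasDerivWithinAt_const t (Ici 0) v).inner ℝ (h.hasDerivWithinAt_sub_noise i ht.1)
    simpa [inner_sum, real_inner_smul_right, hf t ht] using this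
  obtain ⟨K, hK⟩ : ∃ K : ℝ, ∀ t ∈ Icc 0 T, ∀ i j, |A t i j| ≤ K := by
    have : ∀ p : ι × ι, ∃ K : ℝ, ∀ t ∈ Icc 0 T, |A t p.1 p.2| ≤ K := fun p =>
      isCompact_Icc.exists_bound_of_continuousOn (h.continuous_coeff p.1 p.2).continuousOn
    choose K hK using this
    refine ⟨∑ p, |K p|, fun t ht i j => (hK (i, j) t ht).trans ((le_abs_self _).trans ?_)⟩
    exact Finset.single_le_sum (f := fun p => |K p|) (fun _ _ => abs_nonneg _)
      (Finset.mem_univ (i, j))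
  have key := eq_zero_of_abs_deriv_le_mul_abs_self_of_eq_zero_right
    (f := f) (f' := fun t i => ∑ j, A t i j * f t j) (K := Fintype.card ι * K) (a := 0) (b := T)
    (fun t ht => ((hder t ht).continuousWithinAt).mono Icc_subset_Ici_self)
    (fun t ht => (hder t ⟨ht.1, ht.2.le⟩).mono (Ici_subset_Ici.2 ht.1))
    (by ext i; simp [f, h0, h.noise_zero])
    (fun t ht => by
      have hK0 : 0 ≤ Fintype.card ι * K * ‖f t‖ := by
        rcases isEmpty_or_nonempty ι with hι | ⟨⟨i⟩⟩
        · simp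
        · have := (abs_nonneg _).trans (hK t ⟨ht.1, ht.2.le⟩ i i)
          positivity
      rw [pi_norm_le_iff_of_nonneg hK0]
      intro i
      calc ‖∑ j, A t i j * f t j‖ ≤ ∑ j, ‖A t i j * f t j‖ := norm_sum_le _ _
        _ ≤ ∑ _j : ι, K * ‖f t‖ := Finset.sum_le_sum fun j _ => by
            rw [norm_mul]
            have := hK t ⟨ht.1, ht.2.le⟩ i j
            exact mul_le_mul this (norm_le_pi_norm _ _) (norm_nonneg _)
              ((abs_nonneg _).trans this)
        _ = Fintype.card ι * K * ‖f t‖ := by simp [mul_assoc])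
  rw [← hf t ht, key t ht]; rfl

/-- The inner products of the solution with a fixed vector orthogonal to the noise solve the
homogeneous equation. -/
lemma hasDerivWithinAt_inner_const (h : IsLinearIntegralSolution A z w) {v : H}
    (hw : ∀ i, ∀ s, 0 ≤ s → ⟪v, w i s⟫_ℝ = 0) (i : ι) {t : ℝ} (ht : 0 ≤ t) :
    HasDerivWithinAt (fun s => ⟪v, z i s⟫_ℝ) (∑ j, A t i j * ⟪v, z j t⟫_ℝ) (Ici 0) t := by
  have := (hasDerivWithinAt_const t (Ici 0) v).inner ℝ (h.hasDerivWithinAt_sub_noise i ht)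
  simp only [inner_sum, real_inner_smul_right, inner_zero_left, add_zero] at this
  exact this.congr (fun s hs => by rw [inner_sub_right, hw i s hs, sub_zero])
    (by rw [inner_sub_right, hw i t ht, sub_zero])

/-- When the noise has the covariance of a Brownian motion and is orthogonal to the initial values,
its increment after time `s` is orthogonal to the solution at time `s`. -/
lemma inner_noise_eq (h : IsLinearIntegralSolution A z w) {q : ι → ι → ℝ}
    (hww : ∀ i j, ∀ s, 0 ≤ s → ∀ t, 0 ≤ t → ⟪w i s, w j t⟫_ℝ = q i j * min s t)
    (hzw : ∀ i j, ∀ t, 0 ≤ t → ⟪z i 0, w j t⟫_ℝ = 0) (i j : ι) {s t : ℝ} (hs : 0 ≤ s)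
    (hst : s ≤ t) : ⟪z i s, w j t⟫_ℝ = ⟪z i s, w j s⟫_ℝ := by
  have ht := hs.trans hst
  have := h.inner_eq_zero (v := w j t - w j s) (T := s)
    (fun i => by
      rw [inner_sub_left, real_inner_comm, hzw i j t ht, real_inner_comm, hzw i j s hs, sub_zero])
    (fun i r hr => by
      rw [inner_sub_left, hww j i t ht r hr.1, hww j i s hs r hr.1, min_eq_right hr.2,
        min_eq_right (hr.2.trans hst), sub_self]) i ⟨hs, le_rfl⟩
  rw [inner_sub_left, sub_eq_zero, real_inner_comm, real_inner_comm (z i s)] at this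
  exact this

/-- The cross terms `⟪z - w, w⟫` are differentiable although `w` is not: the increments of `w` after
time `r` do not contribute to `⟪z k r, w j s⟫` under the integral. -/
lemma hasDerivWithinAt_inner_noise (h : IsLinearIntegralSolution A z w) {q : ι → ι → ℝ}
    (hww : ∀ i j, ∀ s, 0 ≤ s → ∀ t, 0 ≤ t → ⟪w i s, w j t⟫_ℝ = q i j * min s t)
    (hzw : ∀ i j, ∀ t, 0 ≤ t → ⟪z i 0, w j t⟫_ℝ = 0) (i j : ι) {t : ℝ} (ht : 0 ≤ t) :
    HasDerivWithinAt (fun s => ⟪z i s - w i s, w j s⟫_ℝ)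
      (∑ k, A t i k * ⟪z k t, w j t⟫_ℝ) (Ici 0) t := by
  have hcont : Continuous fun s => ∑ k, A s i k * ⟪z k s, w j s⟫_ℝ :=
    continuous_finsetSum _ fun k _ =>
      (h.continuous_coeff i k).mul ((h.continuous k).inner (h.continuous_noise j))
  have hint : ∀ s, 0 ≤ s → ⟪z i s - w i s, w j s⟫_ℝ
      = ∫ r in (0 : ℝ)..s, ∑ k, A r i k * ⟪z k r, w j r⟫_ℝ := by
    intro s hs
    have h1 : z i s - w i s = z i 0 + ∫ r in (0 : ℝ)..s, ∑ k, A r i k • z k r := by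
      rw [h.integral_eq i s hs]; abel
    rw [h1, inner_add_left, hzw i j s hs, zero_add, real_inner_comm,
      intervalIntegral.integral_of_le hs, ← integral_inner, ← intervalIntegral.integral_of_le hs]
    · refine intervalIntegral.integral_congr fun r hr => ?_
      rw [uIcc_of_le hs] at hr
      simp only [inner_sum, real_inner_smul_right]
      refine Finset.sum_congr rfl fun k _ => ?_
      rw [real_inner_comm, h.inner_noise_eq hww hzw k j hr.1 hr.2]
    · exact ((h.continuous_drift i).intervalIntegrable 0 s).1
  exact (hcont.integral_hasStrictDerivAt 0 t).hasDerivAt.hasDerivWithinAt.congr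
    (fun s hs => hint s hs) (hint t ht)

/-- The Gram matrix of the solution solves the Lyapunov equation. The noise is not differentiable,
so the derivative is taken on the decomposition `z = (z - w) + w`: here `z - w` is differentiable,
`⟪w i, w j⟫` is linear in time, and the cross terms are controlled by
`hasDerivWithinAt_inner_noise`. -/
lemma hasDerivWithinAt_inner (h : IsLinearIntegralSolution A z w) {q : ι → ι → ℝ}
    (hww : ∀ i j, ∀ s, 0 ≤ s → ∀ t, 0 ≤ t → ⟪w i s, w j t⟫_ℝ = q i j * min s t)
    (hzw : ∀ i j, ∀ t, 0 ≤ t → ⟪z i 0, w j t⟫_ℝ = 0) (i j : ι) {t : ℝ} (ht : 0 ≤ t) :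
    HasDerivWithinAt (fun s => ⟪z i s, z j s⟫_ℝ)
      ((∑ k, A t i k * ⟪z k t, z j t⟫_ℝ) + (∑ k, A t j k * ⟪z i t, z k t⟫_ℝ) + q i j)
      (Ici 0) t := by
  have h1 := (h.hasDerivWithinAt_sub_noise i ht).inner ℝ (h.hasDerivWithinAt_sub_noise j ht)
  have h2 := h.hasDerivWithinAt_inner_noise hww hzw i j ht
  have h3 := h.hasDerivWithinAt_inner_noise hww hzw j i ht
  have h4 : HasDerivWithinAt (fun s : ℝ => q i j * s) (q i j) (Ici 0) t := by
    simpa using (hasDerivWithinAt_id t (Ici 0)).const_mul (q i j)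
  have h5 := ((h1.add h2).add h3).add h4
  have hdec : ∀ s, 0 ≤ s → ⟪z i s, z j s⟫_ℝ = ⟪z i s - w i s, z j s - w j s⟫_ℝ
      + ⟪z i s - w i s, w j s⟫_ℝ + ⟪z j s - w j s, w i s⟫_ℝ + q i j * s := by
    intro s hs
    have := hww i j s hs s hs
    rw [min_self] at this
    rw [← this, real_inner_comm (w i s) (z j s - w j s)]
    simp only [inner_sub_left, inner_sub_right]
    ring
  refine (h5.congr (fun s hs => hdec s hs) (hdec t ht)).congr_deriv ?_
  simp only [inner_sub_left, inner_sub_right, inner_sum, sum_inner, real_inner_smul_left,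
    real_inner_smul_right, Finset.sum_sub_distrib]
  have e1 : ∑ k, A t j k * ⟪w i t, z k t⟫_ℝ = ∑ k, A t j k * ⟪z k t, w i t⟫_ℝ := by
    simp only [real_inner_comm]
  rw [e1]
  ring

/-- A bounded solution of the weak form of the equation, that is, of the equation tested against
every vector, is a solution. Boundedness makes `z - w` locally Lipschitz, hence `z` continuous and
the integral a Bochner integral. -/
lemma of_weak (hA : ∀ i j, Continuous fun t => A t i j) (hw : ∀ i, Continuous (w i))
    (hz : ∀ i t, z i (max t 0) = z i t)
    (hbdd : ∀ T : ℝ, ∃ C, ∀ i, ∀ t ∈ Icc 0 T, ‖z i t‖ ≤ C)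
    (hint : ∀ (v : H) (j : ι) (T : ℝ), 0 ≤ T →
      IntervalIntegrable (fun s => ⟪v, z j s⟫_ℝ) volume 0 T)
    (hweak : ∀ (v : H) (i : ι) (t : ℝ), 0 ≤ t → ⟪v, z i t⟫_ℝ = ⟪v, z i 0⟫_ℝ
      + (∫ s in (0 : ℝ)..t, ∑ j, A s i j * ⟪v, z j s⟫_ℝ) + ⟪v, w i t⟫_ℝ) :
    IsLinearIntegralSolution A z w := by
  have hint' : ∀ (v : H) (i : ι) (t : ℝ), 0 ≤ t →
      IntervalIntegrable (fun s => ∑ j, A s i j * ⟪v, z j s⟫_ℝ) volume 0 t := by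
    intro v i t ht
    simpa only [Finset.sum_fn] using IntervalIntegrable.sum (μ := volume) (a := 0) (b := t)
      Finset.univ (f := fun j s => A s i j * ⟪v, z j s⟫_ℝ)
      (fun j _ => (hint v j t ht).continuousOn_mul (hA i j).continuousOn)
  have hcont : ∀ i, Continuous (z i) := by
    intro i
    -- On `[0, T]` the difference `z - w` is Lipschitz.
    have hlip : ∀ T : ℝ, ∃ C : ℝ≥0, LipschitzOnWith C (fun t => z i t - w i t) (Icc 0 T) := by
      intro T
      obtain ⟨C, hC⟩ := hbdd T
      have hK : ∀ j, ∃ K : ℝ, ∀ t ∈ Icc 0 T, |A t i j| ≤ K := fun j =>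
        isCompact_Icc.exists_bound_of_continuousOn (hA i j).continuousOn
      choose K hK using hK
      have aux : ∀ s t, 0 ≤ s → s ≤ t → t ≤ T →
          ‖(z i t - w i t) - (z i s - w i s)‖ ≤ (∑ j, |K j| * |C|) * |t - s| := by
        intro s t hs hst htT
        -- Test the weak form against the increment itself.
        set v := (z i t - w i t) - (z i s - w i s) with hv
        have hvv : ⟪v, v⟫_ℝ = ∫ r in s..t, ∑ j, A r i j * ⟪v, z j r⟫_ℝ := by
          have h1 := hweak v i t (hs.trans hst)
          have h2 := hweak v i s hs
          have h3 := intervalIntegral.integral_interval_sub_left (hint' v i t (hs.trans hst))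
            (hint' v i s hs)
          rw [← h3]
          conv_lhs => rw [hv, inner_sub_right, inner_sub_right, inner_sub_right]
          rw [h1, h2]; ring
        have hle : ‖∫ r in s..t, ∑ j, A r i j * ⟪v, z j r⟫_ℝ‖
            ≤ (∑ j, |K j| * (‖v‖ * |C|)) * |t - s| := by
          refine intervalIntegral.norm_integral_le_of_norm_le_const fun r hr => ?_
          rw [uIoc_of_le hst] at hr
          have hr' : r ∈ Icc 0 T := ⟨hs.trans hr.1.le, hr.2.trans htT⟩
          refine (norm_sum_le _ _).trans (Finset.sum_le_sum fun j _ => ?_)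
          rw [norm_mul]
          refine mul_le_mul ((hK j r hr').trans (le_abs_self _)) ?_ (norm_nonneg _) (abs_nonneg _)
          exact (norm_inner_le_norm _ _).trans
            (mul_le_mul_of_nonneg_left ((hC j r hr').trans (le_abs_self _)) (norm_nonneg _))
        rw [← hvv, real_inner_self_eq_norm_sq, Real.norm_of_nonneg (by positivity)] at hle
        have e : (∑ j, |K j| * (‖v‖ * |C|)) = ‖v‖ * ∑ j, |K j| * |C| := by
          rw [Finset.mul_sum]; exact Finset.sum_congr rfl fun _ _ => by ring
        rw [e, sq, mul_assoc] at hle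
        rcases (norm_nonneg v).eq_or_lt with h0 | h0
        · rw [← h0]; positivity
        · exact le_of_mul_le_mul_left hle h0
      refine ⟨(∑ j, |K j| * |C|).toNNReal, LipschitzOnWith.of_dist_le_mul fun t ht s hs => ?_⟩
      rw [Real.coe_toNNReal _ (by positivity), dist_eq_norm, Real.dist_eq]
      rcases le_total s t with hst | hst
      · exact aux s t hs.1 hst ht.2
      · rw [norm_sub_rev, abs_sub_comm]; exact aux t s ht.1 hst hs.2
    have hon : ContinuousOn (fun t => z i t - w i t) (Ici 0) := by
      intro t ht
      obtain ⟨C, hC⟩ := hlip (t + 1)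
      have := hC.continuousOn t ⟨ht, (lt_add_one t).le⟩
      refine this.mono_of_mem_nhdsWithin ?_
      exact Filter.inter_mem self_mem_nhdsWithin
        (mem_nhdsWithin_of_mem_nhds (Iic_mem_nhds (lt_add_one t)))
    have hon' : ContinuousOn (z i) (Ici 0) := by
      simpa [Pi.add_def] using hon.add (hw i).continuousOn
    have : z i = z i ∘ fun t => max t 0 := by ext t; simp [hz]
    rw [this]
    exact hon'.comp_continuous (by fun_prop) fun t => mem_Ici.2 (le_max_right _ _)
  refine ⟨hA, hcont, hw, fun i t ht => ext_inner_left ℝ fun v => ?_⟩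
  have hd : Continuous fun s => ∑ j, A s i j • z j s :=
    continuous_finsetSum _ fun j _ => (hA i j).smul (hcont j)
  rw [inner_add_right, inner_add_right, hweak v i t ht, intervalIntegral.integral_of_le ht,
    intervalIntegral.integral_of_le ht, ← integral_inner (hd.intervalIntegrable 0 t).1]
  simp only [inner_sum, real_inner_smul_right]

end IsLinearIntegralSolution

/-! ### Gaussian processes and their closed linear span in `L²` -/

section GaussianProcess

variable {Ω : Type*} {mΩ : MeasurableSpace Ω} {P : Measure Ω}

/-- Independent Gaussian processes are jointly Gaussian. -/
lemma isGaussianProcess_of_iIndepFun {ι T : Type*} [Fintype ι] {X : ι → T → Ω → ℝ}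
    (hX : ∀ i, IsGaussianProcess (X i) P) (hindep : iIndepFun (fun i ω t => X i t ω) P) :
    IsGaussianProcess (fun (p : ι × T) ω => X p.1 p.2 ω) P where
  hasGaussianLaw K := by
    classical
    let J := K.image Prod.snd
    have h1 : HasGaussianLaw (fun ω (i : ι) => J.restrict (fun t => X i t ω)) P :=
      iIndepFun.hasGaussianLaw (fun i => (hX i).hasGaussianLaw J)
        (hindep.comp (fun _ => J.restrict) fun _ => Finset.measurable_restrict J)
    let L : (ι → J → ℝ) →L[ℝ] K → ℝ :=
      ContinuousLinearMap.pi fun p =>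
        (ContinuousLinearMap.proj (R := ℝ) (φ := fun _ : J => ℝ)
          ⟨p.1.2, Finset.mem_image_of_mem _ p.2⟩).comp (ContinuousLinearMap.proj p.1.1)
    exact h1.map L

/-- Two independent Gaussian processes are jointly Gaussian. -/
lemma isGaussianProcess_sumElim {S T : Type*} {X : S → Ω → ℝ} {Y : T → Ω → ℝ}
    (hX : IsGaussianProcess X P) (hY : IsGaussianProcess Y P)
    (hindep : IndepFun (fun ω s => X s ω) (fun ω t => Y t ω) P) :
    IsGaussianProcess (Sum.elim X Y) P where
  hasGaussianLaw K := by
    have h1 : HasGaussianLaw (fun ω => (K.toLeft.restrict (fun s => X s ω),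
        K.toRight.restrict (fun t => Y t ω))) P :=
      IndepFun.hasGaussianLaw (hX.hasGaussianLaw _) (hY.hasGaussianLaw _)
        (hindep.comp (Finset.measurable_restrict _) (Finset.measurable_restrict _))
    let L : (K.toLeft → ℝ) × (K.toRight → ℝ) →L[ℝ] K → ℝ :=
      ContinuousLinearMap.pi fun k => match k with
        | ⟨.inl s, hs⟩ => (ContinuousLinearMap.proj (R := ℝ) (φ := fun _ : K.toLeft => ℝ)
            ⟨s, Finset.mem_toLeft.2 hs⟩).comp (ContinuousLinearMap.fst ℝ _ _)
        | ⟨.inr t, ht⟩ => (ContinuousLinearMap.proj (R := ℝ) (φ := fun _ : K.toRight => ℝ)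
            ⟨t, Finset.mem_toRight.2 ht⟩).comp (ContinuousLinearMap.snd ℝ _ _)
    refine (h1.map L).congr (.of_forall fun ω => ?_)
    ext ⟨k, hk⟩
    cases k <;> rfl

lemma coeFn_finsetSum_smul_toLp {ι : Type*} {f : ι → Ω → ℝ} (hf : ∀ i, MemLp (f i) 2 P)
    (s : Finset ι) (c : ι → ℝ) :
    ⇑(∑ i ∈ s, c i • (hf i).toLp) =ᵐ[P] fun ω => ∑ i ∈ s, c i * f i ω := by
  have h1 : ∀ᵐ ω ∂P, ∀ i ∈ s, (c i • (hf i).toLp : Lp ℝ 2 P) ω = c i * f i ω := by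
    rw [Finset.eventually_all]
    intro i _
    filter_upwards [Lp.coeFn_smul (c i) (hf i).toLp, (hf i).coeFn_toLp] with ω h2 h3
    rw [h2, Pi.smul_apply, h3, smul_eq_mul]
  filter_upwards [Lp.coeFn_fun_finsetSum s fun i => c i • (hf i).toLp, h1] with ω h2 h3
  rw [h2]
  exact Finset.sum_congr rfl h3

variable [IsProbabilityMeasure P]

lemma integral_eq_inner_one (X : Lp ℝ 2 P) :
    ∫ ω, X ω ∂P
      = inner ℝ (indicatorConstLp 2 MeasurableSet.univ (measure_ne_top P _) (1 : ℝ)) X := by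
  rw [L2.inner_indicatorConstLp_one, setIntegral_univ]

lemma continuous_integral_Lp_two : Continuous fun X : Lp ℝ 2 P => ∫ ω, X ω ∂P := by
  simp_rw [integral_eq_inner_one]
  fun_prop

lemma continuous_variance_Lp_two : Continuous fun X : Lp ℝ 2 P => Var[X; P] := by
  have h : ∀ X : Lp ℝ 2 P, Var[X; P] = inner ℝ X X - (∫ ω, X ω ∂P) ^ 2 := fun X => by
    rw [variance_eq_sub (Lp.memLp X), L2.inner_def]
    congr 2 with ω
    simp [sq]
  simp_rw [h]
  exact (continuous_id.inner continuous_id).sub (continuous_integral_Lp_two.pow 2)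

lemma integral_abs_le_norm_Lp_two (X : Lp ℝ 2 P) : ∫ ω, |X ω| ∂P ≤ ‖X‖ := by
  have h1 : eLpNorm X 1 P ≤ eLpNorm X 2 P :=
    eLpNorm_le_eLpNorm_of_exponent_le (by norm_num) (Lp.aestronglyMeasurable X)
  have h2 := ENNReal.toReal_mono (Lp.eLpNorm_ne_top X) h1
  rwa [← Lp.norm_def, eLpNorm_one_eq_lintegral_enorm,
    ← integral_norm_eq_lintegral_enorm (Lp.aestronglyMeasurable X)] at h2

lemma continuous_charFun_Lp_two (t : ℝ) :
    Continuous fun X : Lp ℝ 2 P => charFun (P.map X) t := by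
  have hint : ∀ X : Lp ℝ 2 P, Integrable (fun ω => Complex.exp (t * X ω * Complex.I)) P := by
    intro X
    refine Integrable.of_bound (C := 1) ?_ (.of_forall fun ω => ?_)
    · have := (Lp.aestronglyMeasurable X).aemeasurable
      exact AEMeasurable.aestronglyMeasurable (by fun_prop)
    · rw [← Complex.ofReal_mul, Complex.norm_exp_ofReal_mul_I]
  refine LipschitzWith.continuous (K := ⟨|t|, abs_nonneg t⟩)
    (LipschitzWith.of_dist_le_mul fun X Y => ?_)
  have hX := (Lp.aestronglyMeasurable X).aemeasurable
  have hY := (Lp.aestronglyMeasurable Y).aemeasurable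
  rw [charFun_apply_real, charFun_apply_real, integral_map hX (by fun_prop),
    integral_map hY (by fun_prop), dist_eq_norm, ← integral_sub (hint X) (hint Y), dist_eq_norm]
  have hpt : ∀ ω, ‖Complex.exp (t * X ω * Complex.I) - Complex.exp (t * Y ω * Complex.I)‖
      ≤ |t| * |X ω - Y ω| := by
    intro ω
    have e : Complex.exp (t * X ω * Complex.I) - Complex.exp (t * Y ω * Complex.I)
        = Complex.exp ((t * Y ω : ℝ) * Complex.I)
          * (Complex.exp (Complex.I * (t * (X ω - Y ω) : ℝ)) - 1) := by
      rw [mul_sub, ← Complex.exp_add, mul_one]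
      congr 2
      · push_cast; ring
      · push_cast; ring
    rw [e, norm_mul, Complex.norm_exp_ofReal_mul_I, one_mul, ← abs_mul]
    exact Real.norm_exp_I_mul_ofReal_sub_one_le
  have hsub : (fun ω => |t| * |X ω - Y ω|) =ᵐ[P] fun ω => |t| * |(X - Y : Lp ℝ 2 P) ω| := by
    filter_upwards [Lp.coeFn_sub X Y] with ω hω
    rw [hω]; rfl
  calc ‖∫ ω, (Complex.exp (t * X ω * Complex.I) - Complex.exp (t * Y ω * Complex.I)) ∂P‖
      ≤ ∫ ω, |t| * |(X - Y : Lp ℝ 2 P) ω| ∂P := by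
        refine norm_integral_le_of_norm_le ?_ ?_
        · exact (((Lp.memLp (X - Y)).integrable (by norm_num)).abs).const_mul _
        · filter_upwards [hsub] with ω hω
          exact (hpt ω).trans_eq hω
    _ = |t| * ∫ ω, |(X - Y : Lp ℝ 2 P) ω| ∂P := integral_const_mul _ _
    _ ≤ |t| * ‖X - Y‖ :=
        mul_le_mul_of_nonneg_left (integral_abs_le_norm_Lp_two _) (abs_nonneg t)

/-- `L²` limits of Gaussian random variables are Gaussian: the characteristic function, the mean
and the variance are continuous on `L²`. -/
lemma isClosed_hasGaussianLaw_Lp_two : IsClosed {X : Lp ℝ 2 P | HasGaussianLaw X P} := by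
  have h : {X : Lp ℝ 2 P | HasGaussianLaw X P} = ⋂ t : ℝ, {X : Lp ℝ 2 P | charFun (P.map X) t
      = Complex.exp ((t * ∫ ω, X ω ∂P : ℝ) * Complex.I - (t ^ 2 * Var[X; P] : ℝ) / 2)} := by
    ext X
    rw [mem_ofPred_eq,
      hasGaussianLaw_iff_charFun_map_eq (Lp.aestronglyMeasurable X).aemeasurable, mem_iInter]
    refine forall_congr' fun t => ?_
    have e : (fun ω => inner ℝ t (X ω)) = fun ω => t * X ω := by
      ext ω; simp [mul_comm]
    rw [mem_ofPred_eq, e, variance_const_mul, integral_const_mul]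
  rw [h]
  refine isClosed_iInter fun t => isClosed_eq (continuous_charFun_Lp_two t) ?_
  have := continuous_integral_Lp_two (P := P)
  have := continuous_variance_Lp_two (P := P)
  fun_prop

/-- The closed linear span in `L²` of a Gaussian process consists of Gaussian random variables. -/
lemma hasGaussianLaw_of_mem_orthogonal_orthogonal_span {T : Type*} {X : T → Ω → ℝ}
    (hX : IsGaussianProcess X P) {Y : Lp ℝ 2 P}
    (hY : Y ∈ (Submodule.span ℝ
      (range fun t => (hX.hasGaussianLaw_eval t).memLp_two.toLp (X t)))ᗮᗮ) :
    HasGaussianLaw Y P := by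
  rw [Submodule.orthogonal_orthogonal_eq_closure] at hY
  refine closure_minimal ?_ isClosed_hasGaussianLaw_Lp_two hY
  intro Y hY
  obtain ⟨c, rfl⟩ := (Finsupp.mem_span_range_iff_exists_finsupp).1 hY
  refine ((hX.smul c).hasGaussianLaw_fun_sum (I := c.support)).congr ?_
  exact (coeFn_finsetSum_smul_toLp (fun t => (hX.hasGaussianLaw_eval t).memLp_two) c.support c).symm

/-- A random vector is Gaussian if its coordinates lie in the closed linear span of a Gaussian
process. -/
lemma hasGaussianLaw_euclideanSpace_of_mem {n : ℕ} {T : Type*} {X : T → Ω → ℝ}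
    (hX : IsGaussianProcess X P) {Y : Ω → EuclideanSpace ℝ (Fin n)} (hYm : Measurable Y)
    (hY2 : ∀ i, MemLp (fun ω => Y ω i) 2 P)
    (hY : ∀ i, (hY2 i).toLp ∈ (Submodule.span ℝ
      (range fun t => (hX.hasGaussianLaw_eval t).memLp_two.toLp (X t)))ᗮᗮ) :
    HasGaussianLaw Y P := by
  refine ⟨isGaussian_of_isGaussian_map fun L => ?_⟩
  rw [Measure.map_map (by fun_prop) hYm]
  suffices h : HasGaussianLaw (L ∘ Y) P from h.isGaussian_map
  have hsum : ∀ ω, L (Y ω) = ∑ i, L (EuclideanSpace.single i 1) * Y ω i := by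
    intro ω
    conv_lhs => rw [← (EuclideanSpace.basisFun (Fin n) ℝ).sum_repr (Y ω)]
    simp [mul_comm]
  have h2 := hasGaussianLaw_of_mem_orthogonal_orthogonal_span hX
    (Submodule.sum_mem _ fun i (_ : i ∈ Finset.univ) =>
      Submodule.smul_mem _ (L (EuclideanSpace.single i 1)) (hY i))
  refine h2.congr ((coeFn_finsetSum_smul_toLp hY2 _ _).trans (.of_forall fun ω => ?_))
  exact (hsum ω).symm

end GaussianProcess

/-! ### A pathwise Grönwall bound -/

/-- Grönwall's inequality for `z t = z 0 + ∫₀ᵗ a s (z s) ds + w t`, with a bound that involves the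
noise `w` only through its value at `t` and its integral, so that no maximal inequality is needed
to take moments. -/
lemma norm_le_of_linear_integral_eq {E : Type*} [NormedAddCommGroup E] [NormedSpace ℝ E]
    {a : ℝ → E →L[ℝ] E} {z w : ℝ → E} {K T : ℝ}
    (hK : ∀ s ∈ Icc 0 T, ‖a s‖ ≤ K) (hz : Continuous z) (hw : Continuous w)
    (heq : ∀ t ∈ Icc 0 T, z t = z 0 + (∫ s in (0 : ℝ)..t, a s (z s)) + w t)
    {t : ℝ} (ht : t ∈ Icc 0 T) :
    ‖z t‖ ≤ ‖z 0‖ + ‖w t‖ + K * Real.exp (K * T) * ∫ s in (0 : ℝ)..T, (‖z 0‖ + ‖w s‖) := by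
  have hK0 : 0 ≤ K := (norm_nonneg _).trans (hK t ht)
  set h : ℝ → ℝ := fun s => ‖z 0‖ + ‖w s‖ with hh
  have hhc : Continuous h := by fun_prop
  set u : ℝ → ℝ := fun r => ∫ s in (0 : ℝ)..r, ‖z s‖ with hu
  have hzu : ∀ r ∈ Icc 0 T, ‖z r‖ ≤ h r + K * u r := by
    intro r hr
    have h1 : ‖∫ s in (0 : ℝ)..r, a s (z s)‖ ≤ ∫ s in (0 : ℝ)..r, K * ‖z s‖ := by
      refine intervalIntegral.norm_integral_le_of_norm_le hr.1 (.of_forall fun s hs => ?_)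
        ((continuous_const.mul hz.norm).intervalIntegrable _ _)
      exact ((a s).le_opNorm _).trans
        (mul_le_mul_of_nonneg_right (hK s ⟨hs.1.le, hs.2.trans hr.2⟩) (norm_nonneg _))
    rw [intervalIntegral.integral_const_mul] at h1
    have h2 := (congrArg norm (heq r hr)).le.trans (norm_add₃_le)
    simp only [hh, hu]
    linarith
  have hud : ∀ r, HasDerivAt u ‖z r‖ r := fun r =>
    (hz.norm.integral_hasStrictDerivAt 0 r).hasDerivAt
  -- With the integrating factor `exp (-K r)`, the gap `g` is nondecreasing and `g 0 = 0`.
  set g : ℝ → ℝ := fun r => (∫ s in (0 : ℝ)..r, h s) - u r * Real.exp (-(K * r)) with hg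
  have hgd : ∀ r, HasDerivAt g (h r - (‖z r‖ * Real.exp (-(K * r))
      + u r * (Real.exp (-(K * r)) * -(K * 1)))) r := fun r =>
    (hhc.integral_hasStrictDerivAt 0 r).hasDerivAt.sub
      ((hud r).mul (((hasDerivAt_id r).const_mul K).neg.exp))
  have hmono : MonotoneOn g (Icc 0 T) := by
    refine monotoneOn_of_deriv_nonneg (convex_Icc 0 T)
      (fun r _ => (hgd r).continuousAt.continuousWithinAt)
      (fun r _ => (hgd r).differentiableAt.differentiableWithinAt) fun r hr => ?_
    rw [interior_Icc] at hr
    rw [(hgd r).deriv]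
    have h1 := hzu r ⟨hr.1.le, hr.2.le⟩
    have h2 : Real.exp (-(K * r)) ≤ 1 := Real.exp_le_one_iff.2 (by nlinarith [hr.1])
    have h3 : 0 ≤ h r := by positivity
    nlinarith [Real.exp_pos (-(K * r)), mul_le_mul_of_nonneg_right h1 (Real.exp_pos (-(K * r))).le,
      mul_le_mul_of_nonneg_left h2 h3]
  have hut : u t ≤ Real.exp (K * T) * ∫ s in (0 : ℝ)..T, h s := by
    have h1 := hmono ⟨le_rfl, ht.1.trans ht.2⟩ ht ht.1
    have h2 : u t * Real.exp (-(K * t)) ≤ ∫ s in (0 : ℝ)..t, h s := by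
      simpa [hg, hu] using h1
    have h3 : ∫ s in (0 : ℝ)..t, h s ≤ ∫ s in (0 : ℝ)..T, h s :=
      intervalIntegral.integral_mono_interval le_rfl ht.1 ht.2
        (.of_forall fun s => by positivity) (hhc.intervalIntegrable _ _)
    have h4 : 0 ≤ ∫ s in (0 : ℝ)..T, h s :=
      intervalIntegral.integral_nonneg (ht.1.trans ht.2) fun s _ => by positivity
    rw [Real.exp_neg, ← div_eq_mul_inv, div_le_iff₀ (Real.exp_pos _)] at h2
    calc u t ≤ (∫ s in (0 : ℝ)..T, h s) * Real.exp (K * t) :=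
          h2.trans (mul_le_mul_of_nonneg_right h3 (Real.exp_pos _).le)
      _ ≤ (∫ s in (0 : ℝ)..T, h s) * Real.exp (K * T) :=
          mul_le_mul_of_nonneg_left
            (Real.exp_le_exp.2 (mul_le_mul_of_nonneg_left ht.2 hK0)) h4
      _ = _ := mul_comm _ _
  calc ‖z t‖ ≤ h t + K * u t := hzu t ht
    _ ≤ h t + K * (Real.exp (K * T) * ∫ s in (0 : ℝ)..T, h s) := by gcongr
    _ = _ := by ring

/-- The Cauchy–Schwarz inequality against the constant function `1`. -/
lemma sq_intervalIntegral_le {h : ℝ → ℝ} (hh : Continuous h) {T : ℝ} (hT : 0 ≤ T) :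
    (∫ s in (0 : ℝ)..T, h s) ^ 2 ≤ T * ∫ s in (0 : ℝ)..T, h s ^ 2 := by
  rcases hT.eq_or_lt with rfl | hT
  · simp
  set m := ∫ s in (0 : ℝ)..T, h s with hm
  -- Expand the integral of the square of `T * h - m`, where `m` is the integral of `h`.
  have h0 : 0 ≤ ∫ s in (0 : ℝ)..T, (T * h s - m) ^ 2 :=
    intervalIntegral.integral_nonneg hT.le fun s _ => sq_nonneg _
  have h1 : ∫ s in (0 : ℝ)..T, (T * h s - m) ^ 2
      = ∫ s in (0 : ℝ)..T, (T ^ 2 * h s ^ 2 - 2 * T * m * h s + m ^ 2) :=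
    intervalIntegral.integral_congr fun s _ => by ring
  rw [h1, intervalIntegral.integral_add, intervalIntegral.integral_sub,
    intervalIntegral.integral_const_mul, intervalIntegral.integral_const_mul,
    intervalIntegral.integral_const, ← hm, smul_eq_mul] at h0
  · have : 0 ≤ T * (T * (∫ s in (0 : ℝ)..T, h s ^ 2) - m ^ 2) := by nlinarith
    linarith [nonneg_of_mul_nonneg_right this hT]
  all_goals exact Continuous.intervalIntegrable (by fun_prop) _ _

/-! ### Second moments of the solution -/

section SecondMoments

variable {Ω : Type*} {mΩ : MeasurableSpace Ω} {P : Measure Ω} [IsProbabilityMeasure P]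

lemma integrable_prod_of_integral_norm_le {f : ℝ → Ω → ℝ} {T C : ℝ}
    (hf : AEStronglyMeasurable (Function.uncurry f) ((volume.restrict (Ioc 0 T)).prod P))
    (hint : ∀ s ∈ Ioc 0 T, Integrable (f s) P) (hC : ∀ s ∈ Ioc 0 T, ∫ ω, ‖f s ω‖ ∂P ≤ C) :
    Integrable (Function.uncurry f) ((volume.restrict (Ioc 0 T)).prod P) := by
  rw [integrable_prod_iff hf]
  refine ⟨?_, ?_⟩
  · filter_upwards [ae_restrict_mem measurableSet_Ioc] with s hs using hint s hs
  · refine Integrable.of_bound (C := C) hf.norm.integral_prod_right' ?_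
    filter_upwards [ae_restrict_mem measurableSet_Ioc] with s hs
    rw [Real.norm_of_nonneg (integral_nonneg fun _ => norm_nonneg _)]
    exact hC s hs

variable {n : ℕ}

/-- Square integrability of a linear stochastic integral equation, uniformly on bounded time
intervals. -/
lemma exists_integral_norm_sq_le {a : ℝ → EuclideanSpace ℝ (Fin n) →L[ℝ] EuclideanSpace ℝ (Fin n)}
    {Z W : ℝ → Ω → EuclideanSpace ℝ (Fin n)} {K T : ℝ}
    (hK : ∀ s ∈ Icc 0 T, ‖a s‖ ≤ K)
    (hZm : ∀ t, Measurable (Z t)) (hWm : ∀ t, Measurable (W t))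
    (hZc : ∀ ω, Continuous fun t => Z t ω) (hWc : ∀ ω, Continuous fun t => W t ω)
    (heq : ∀ ω, ∀ t ∈ Icc 0 T, Z t ω = Z 0 ω + (∫ s in (0 : ℝ)..t, a s (Z s ω)) + W t ω)
    (hZ0 : Integrable (fun ω => ‖Z 0 ω‖ ^ 2) P)
    (hW : ∀ t ∈ Icc 0 T, Integrable (fun ω => ‖W t ω‖ ^ 2) P)
    {C : ℝ} (hWC : ∀ t ∈ Icc 0 T, ∫ ω, ‖W t ω‖ ^ 2 ∂P ≤ C) :
    ∃ C', ∀ t ∈ Icc 0 T, Integrable (fun ω => ‖Z t ω‖ ^ 2) P ∧ ∫ ω, ‖Z t ω‖ ^ 2 ∂P ≤ C' := by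
  rcases lt_or_ge T 0 with hT | hT
  · exact ⟨0, fun t ht => absurd (ht.1.trans ht.2) (not_le.2 hT)⟩
  let h : ℝ → Ω → ℝ := fun t ω => ‖Z 0 ω‖ + ‖W t ω‖
  have hhc : ∀ ω, Continuous fun t => h t ω := fun ω => by
    have := hWc ω
    fun_prop
  have hhm : Measurable (Function.uncurry h) :=
    measurable_uncurry_of_continuous_of_measurable hhc
      fun t => (hZm 0).norm.add (hWm t).norm
  have hdom : ∀ t ∈ Icc 0 T, Integrable (fun ω => 2 * ‖Z 0 ω‖ ^ 2 + 2 * ‖W t ω‖ ^ 2) P :=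
    fun t ht => (hZ0.const_mul 2).add ((hW t ht).const_mul 2)
  have hle : ∀ t ω, h t ω ^ 2 ≤ 2 * ‖Z 0 ω‖ ^ 2 + 2 * ‖W t ω‖ ^ 2 := fun t ω => by
    nlinarith [sq_nonneg (‖Z 0 ω‖ - ‖W t ω‖)]
  have hh2 : ∀ t ∈ Icc 0 T, Integrable (fun ω => h t ω ^ 2) P := fun t ht =>
    (hdom t ht).mono' (((hZm 0).norm.add (hWm t).norm).pow_const 2).aestronglyMeasurable
      (.of_forall fun ω => by
        rw [Real.norm_of_nonneg (sq_nonneg _)]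
        exact hle t ω)
  set C₁ := 2 * (∫ ω, ‖Z 0 ω‖ ^ 2 ∂P) + 2 * C with hC₁
  have hhC : ∀ t ∈ Icc 0 T, ∫ ω, h t ω ^ 2 ∂P ≤ C₁ := fun t ht => by
    refine (integral_mono (hh2 t ht) (hdom t ht) (hle t)).trans ?_
    rw [integral_add (hZ0.const_mul 2) ((hW t ht).const_mul 2), integral_const_mul,
      integral_const_mul]
    linarith [hWC t ht]
  let M : Ω → ℝ := fun ω => ∫ s in (0 : ℝ)..T, h s ω
  have hMm : Measurable M := by
    have : StronglyMeasurable fun ω => ∫ s, h s ω ∂(volume.restrict (Ioc 0 T)) :=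
      hhm.stronglyMeasurable.integral_prod_left
    simpa only [M, intervalIntegral.integral_of_le hT] using this.measurable
  have hprod : Integrable (Function.uncurry fun s ω => h s ω ^ 2)
      ((volume.restrict (Ioc 0 T)).prod P) := by
    refine integrable_prod_of_integral_norm_le (C := C₁) (hhm.pow_const 2).aestronglyMeasurable
      (fun s hs => hh2 s ⟨hs.1.le, hs.2⟩) fun s hs => ?_
    simp only [norm_pow, sq_abs, Real.norm_eq_abs]
    exact hhC s ⟨hs.1.le, hs.2⟩
  have hM2 : Integrable (fun ω => M ω ^ 2) P := by
    refine (hprod.integral_prod_right.const_mul T).mono' (hMm.pow_const 2).aestronglyMeasurable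
      (.of_forall fun ω => ?_)
    rw [Real.norm_of_nonneg (sq_nonneg _)]
    have := sq_intervalIntegral_le (hhc ω) hT
    rwa [intervalIntegral.integral_of_le hT (f := fun s => h s ω ^ 2)] at this
  set c := K * Real.exp (K * T)
  have hZle : ∀ t ∈ Icc 0 T, ∀ ω, ‖Z t ω‖ ^ 2 ≤ 2 * h t ω ^ 2 + 2 * c ^ 2 * M ω ^ 2 := by
    intro t ht ω
    have := norm_le_of_linear_integral_eq hK (hZc ω) (hWc ω) (heq ω) ht
    have h2 : ‖Z t ω‖ ^ 2 ≤ (h t ω + c * M ω) ^ 2 :=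
      pow_le_pow_left₀ (norm_nonneg _) this 2
    nlinarith [sq_nonneg (h t ω - c * M ω)]
  have hb : ∀ t ∈ Icc 0 T, Integrable (fun ω => 2 * h t ω ^ 2 + 2 * c ^ 2 * M ω ^ 2) P :=
    fun t ht => ((hh2 t ht).const_mul 2).add (hM2.const_mul _)
  refine ⟨2 * C₁ + 2 * c ^ 2 * ∫ ω, M ω ^ 2 ∂P, fun t ht => ?_⟩
  have hi : Integrable (fun ω => ‖Z t ω‖ ^ 2) P :=
    (hb t ht).mono' ((hZm t).norm.pow_const 2).aestronglyMeasurable (.of_forall fun ω => by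
      rw [Real.norm_of_nonneg (sq_nonneg _)]
      exact hZle t ht ω)
  refine ⟨hi, (integral_mono hi (hb t ht) (hZle t ht)).trans ?_⟩
  rw [integral_add ((hh2 t ht).const_mul 2) (hM2.const_mul _), integral_const_mul,
    integral_const_mul]
  linarith [hhC t ht]

end SecondMoments

/-! ### From pathwise solutions to equations in `L²` -/

section SquareIntegrableSolution

variable {Ω : Type*} {mΩ : MeasurableSpace Ω} {P : Measure Ω}

lemma inner_toLp_two (v : Lp ℝ 2 P) {f : Ω → ℝ} (hf : MemLp f 2 P) :
    inner ℝ v hf.toLp = ∫ ω, v ω * f ω ∂P := by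
  rw [L2.inner_def]
  refine integral_congr_ae ?_
  filter_upwards [hf.coeFn_toLp] with ω hω
  simp [hω, mul_comm]

lemma inner_toLp_toLp_two {f g : Ω → ℝ} (hf : MemLp f 2 P) (hg : MemLp g 2 P) :
    inner ℝ hf.toLp hg.toLp = ∫ ω, f ω * g ω ∂P := by
  rw [inner_toLp_two]
  refine integral_congr_ae ?_
  filter_upwards [hf.coeFn_toLp] with ω hω
  rw [hω]

variable {n : ℕ}

lemma euclideanSpace_sq_le_norm_sq (x : EuclideanSpace ℝ (Fin n)) (i : Fin n) :
    x i ^ 2 ≤ ‖x‖ ^ 2 := by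
  rw [EuclideanSpace.real_norm_sq_eq]
  exact Finset.single_le_sum (f := fun i => x i ^ 2) (fun _ _ => sq_nonneg _) (Finset.mem_univ i)

lemma toEuclideanCLM_apply_coord (A : Matrix (Fin n) (Fin n) ℝ) (x : EuclideanSpace ℝ (Fin n))
    (i : Fin n) : Matrix.toEuclideanCLM (𝕜 := ℝ) A x i = ∑ j, A i j * x j := by
  simp [Matrix.ofLp_toEuclideanCLM, Matrix.mulVec, dotProduct]

lemma continuous_toEuclideanCLM_comp {A : ℝ → Matrix (Fin n) (Fin n) ℝ}
    (hA : ∀ i j, Continuous fun t => A t i j) :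
    Continuous fun t => Matrix.toEuclideanCLM (𝕜 := ℝ) (A t) :=
  (LinearMap.continuous_of_finiteDimensional
    (Matrix.toEuclideanCLM (n := Fin n) (𝕜 := ℝ)).toAlgEquiv.toLinearMap).comp
    (continuous_matrix hA)

lemma memLp_two_coord_of_integrable_norm_sq {X : Ω → EuclideanSpace ℝ (Fin n)} (hX : Measurable X)
    (hX2 : Integrable (fun ω => ‖X ω‖ ^ 2) P) (i : Fin n) : MemLp (fun ω => X ω i) 2 P := by
  have hm : Measurable fun ω => X ω i := by fun_prop
  rw [memLp_two_iff_integrable_sq hm.aestronglyMeasurable]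
  refine hX2.mono' (hm.pow_const 2).aestronglyMeasurable (.of_forall fun ω => ?_)
  rw [Real.norm_of_nonneg (sq_nonneg _)]
  exact euclideanSpace_sq_le_norm_sq _ _

variable [IsProbabilityMeasure P]

/-- The integrability needed for exchanging expectation and time integral. -/
lemma integrable_prod_mul_coord {Z : ℝ → Ω → EuclideanSpace ℝ (Fin n)}
    (hZm : ∀ t, Measurable (Z t)) (hZc : ∀ ω, Continuous fun t => Z t ω) {T C : ℝ}
    (hZ : ∀ t ∈ Icc 0 T, Integrable (fun ω => ‖Z t ω‖ ^ 2) P ∧ ∫ ω, ‖Z t ω‖ ^ 2 ∂P ≤ C)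
    {a : ℝ → ℝ} (ha : Continuous a) (v : Lp ℝ 2 P) (j : Fin n) :
    Integrable (Function.uncurry fun s ω => a s * (v ω * Z s ω j))
      ((volume.restrict (Ioc 0 T)).prod P) := by
  obtain ⟨K, hK⟩ := isCompact_Icc.exists_bound_of_continuousOn (s := Icc 0 T) ha.continuousOn
  have hv2 : Integrable (fun ω => v ω ^ 2) P :=
    (memLp_two_iff_integrable_sq (Lp.aestronglyMeasurable v)).1 (Lp.memLp v)
  have hmem : ∀ s ∈ Ioc 0 T, MemLp (fun ω => Z s ω j) 2 P := fun s hs =>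
    memLp_two_coord_of_integrable_norm_sq (hZm s) (hZ s ⟨hs.1.le, hs.2⟩).1 j
  have hint : ∀ s ∈ Ioc 0 T, Integrable (fun ω => v ω * Z s ω j) P := fun s hs =>
    (Lp.memLp v).integrable_mul (hmem s hs)
  have hZu : Measurable (Function.uncurry Z) :=
    measurable_uncurry_of_continuous_of_measurable hZc hZm
  refine integrable_prod_of_integral_norm_le (C := K * ((∫ ω, v ω ^ 2 ∂P) + C)) ?_
    (fun s hs => (hint s hs).const_mul _) fun s hs => ?_
  · have h1 : AEStronglyMeasurable (fun p : ℝ × Ω => v p.2) ((volume.restrict (Ioc 0 T)).prod P) :=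
      (Lp.aestronglyMeasurable v).comp_snd
    have h2 : Measurable fun p : ℝ × Ω => Z p.1 p.2 j := by
      have : Measurable fun p : ℝ × Ω => Z p.1 p.2 := hZu
      fun_prop
    exact (ha.measurable.comp measurable_fst).aestronglyMeasurable.mul
      (h1.mul h2.aestronglyMeasurable)
  · simp only [norm_mul, Real.norm_eq_abs]
    rw [integral_const_mul]
    have hs' : s ∈ Icc 0 T := ⟨hs.1.le, hs.2⟩
    have h1 : ∫ ω, |v ω| * |Z s ω j| ∂P ≤ ∫ ω, (v ω ^ 2 + ‖Z s ω‖ ^ 2) ∂P := by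
      refine integral_mono (by simpa [abs_mul] using (hint s hs).abs) (hv2.add (hZ s hs').1)
        fun ω => ?_
      have := euclideanSpace_sq_le_norm_sq (Z s ω) j
      have h3 := sq_abs (v ω)
      have h4 := sq_abs (Z s ω j)
      show |v ω| * |Z s ω j| ≤ v ω ^ 2 + ‖Z s ω‖ ^ 2
      nlinarith [sq_nonneg (|v ω| - |Z s ω j|), sq_nonneg (v ω), sq_nonneg (Z s ω j)]
    rw [integral_add hv2 (hZ s hs').1] at h1
    exact mul_le_mul (hK s hs') (h1.trans (by linarith [(hZ s hs').2]))
      (integral_nonneg fun ω => by positivity) ((abs_nonneg _).trans (hK s hs'))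

/-- The coordinates of a pathwise solution with bounded second moments solve the same equation in
`L²`: Fubini's theorem gives its weak form. -/
lemma isLinearIntegralSolution_toLp {A : ℝ → Matrix (Fin n) (Fin n) ℝ}
    (hA : ∀ i j, Continuous fun t => A t i j) {Z W : ℝ → Ω → EuclideanSpace ℝ (Fin n)}
    (hZm : ∀ t, Measurable (Z t)) (hZc : ∀ ω, Continuous fun t => Z t ω)
    (hZmax : ∀ t, Z (max t 0) = Z t)
    (heq : ∀ ω, ∀ t, 0 ≤ t → Z t ω = Z 0 ω
      + (∫ s in (0 : ℝ)..t, Matrix.toEuclideanCLM (𝕜 := ℝ) (A s) (Z s ω)) + W t ω)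
    (hZ : ∀ T : ℝ, ∃ C, ∀ t ∈ Icc 0 T,
      Integrable (fun ω => ‖Z t ω‖ ^ 2) P ∧ ∫ ω, ‖Z t ω‖ ^ 2 ∂P ≤ C)
    (hZ2 : ∀ i t, MemLp (fun ω => Z t ω i) 2 P) (hW2 : ∀ i t, MemLp (fun ω => W t ω i) 2 P)
    (hWc : ∀ i, Continuous fun t => (hW2 i t).toLp) :
    IsLinearIntegralSolution A (fun i t => (hZ2 i t).toLp) (fun i t => (hW2 i t).toLp) := by
  have hfub : ∀ (a : ℝ → ℝ), Continuous a → ∀ (v : Lp ℝ 2 P) (j : Fin n) (T : ℝ),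
      Integrable (Function.uncurry fun s ω => a s * (v ω * Z s ω j))
        ((volume.restrict (Ioc 0 T)).prod P) := fun a ha v j T => by
    obtain ⟨C, hC⟩ := hZ T
    exact integrable_prod_mul_coord hZm hZc hC ha v j
  refine .of_weak hA hWc (fun i t => ?_) (fun T => ?_) (fun v j T hT => ?_) fun v i t ht => ?_
  · simp only [hZmax]
  · obtain ⟨C, hC⟩ := hZ T
    refine ⟨√C, fun i t ht => Real.le_sqrt_of_sq_le ?_⟩
    rw [← real_inner_self_eq_norm_sq, inner_toLp_toLp_two]
    refine le_trans (integral_mono ((hZ2 i t).integrable_mul (hZ2 i t)) (hC t ht).1 fun ω => ?_)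
      (hC t ht).2
    simpa [sq] using euclideanSpace_sq_le_norm_sq (Z t ω) i
  · simp only [inner_toLp_two]
    rw [intervalIntegrable_iff_integrableOn_Ioc_of_le hT]
    simpa [IntegrableOn] using (hfub (fun _ => 1) continuous_const v j T).integral_prod_left
  · simp only [inner_toLp_two]
    -- The drift of the `i`-th coordinate.
    let D : Ω → ℝ := fun ω => ∫ s in (0 : ℝ)..t, ∑ j, A s i j * Z s ω j
    have hpath : ∀ ω, Z t ω i = Z 0 ω i + D ω + W t ω i := by
      intro ω
      have hc : Continuous fun s => Matrix.toEuclideanCLM (𝕜 := ℝ) (A s) (Z s ω) :=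
        (continuous_toEuclideanCLM_comp hA).clm_apply (hZc ω)
      have h1 : (∫ s in (0 : ℝ)..t, Matrix.toEuclideanCLM (𝕜 := ℝ) (A s) (Z s ω)) i = D ω :=
        ((EuclideanSpace.proj (𝕜 := ℝ) i).intervalIntegral_comp_comm
          (hc.intervalIntegrable (μ := volume) 0 t)).symm.trans
          (intervalIntegral.integral_congr fun s _ => toEuclideanCLM_apply_coord _ _ _)
      rw [heq ω t ht, PiLp.add_apply, PiLp.add_apply, h1]
    have hprod : Integrable (Function.uncurry fun s ω => ∑ j, A s i j * (v ω * Z s ω j))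
        ((volume.restrict (Ioc 0 t)).prod P) := by
      have := integrable_finsetSum (μ := (volume.restrict (Ioc 0 t)).prod P) Finset.univ
        fun j _ => hfub (fun s => A s i j) (hA i j) v j t
      simpa only [Function.uncurry_def] using this
    have hvD : ∀ ω, v ω * D ω = ∫ s in (0 : ℝ)..t, ∑ j, A s i j * (v ω * Z s ω j) := by
      intro ω
      rw [← intervalIntegral.integral_const_mul]
      refine intervalIntegral.integral_congr fun s _ => ?_
      simp only [Finset.mul_sum]
      exact Finset.sum_congr rfl fun j _ => by ring
    have hvDi : Integrable (fun ω => v ω * D ω) P := by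
      simp only [hvD, intervalIntegral.integral_of_le ht]
      exact hprod.integral_prod_right
    have hswap : ∫ ω, v ω * D ω ∂P
        = ∫ s in (0 : ℝ)..t, ∑ j, A s i j * ∫ ω, v ω * Z s ω j ∂P := by
      simp only [hvD]
      rw [← intervalIntegral_integral_swap (by rwa [uIoc_of_le ht])]
      refine intervalIntegral.integral_congr fun s _ => ?_
      have hi : ∀ j, Integrable (fun ω => v ω * Z s ω j) P := fun j =>
        (Lp.memLp v).integrable_mul (hZ2 j s)
      rw [integral_finsetSum _ fun j _ => (hi j).const_mul _]
      simp only [integral_const_mul]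
    have h0 : Integrable (fun ω => v ω * Z 0 ω i) P := (Lp.memLp v).integrable_mul (hZ2 i 0)
    have hw : Integrable (fun ω => v ω * W t ω i) P := (Lp.memLp v).integrable_mul (hW2 i t)
    have h0D : Integrable (fun ω => v ω * Z 0 ω i + v ω * D ω) P := h0.add hvDi
    rw [← hswap]
    calc ∫ ω, v ω * Z t ω i ∂P
        = ∫ ω, (v ω * Z 0 ω i + v ω * D ω + v ω * W t ω i) ∂P :=
          integral_congr_ae (.of_forall fun ω => by simp only [hpath ω]; ring)
      _ = _ := by rw [integral_add h0D hw, integral_add h0 hvDi]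

end SquareIntegrableSolution

/-! ### Second-order structure of Brownian noise -/

namespace IsStdBrownianMotion

variable {n : ℕ} {Ω : Type*} [MeasurableSpace Ω] {P : Measure Ω}
  {B : ℝ≥0 → Ω → EuclideanSpace ℝ (Fin n)}

lemma memLp_two (hB : IsStdBrownianMotion B P) (k : Fin n) (t : ℝ≥0) :
    MemLp (fun ω => B t ω k) 2 P :=
  ((IsPreBrownianReal.isGaussianProcess
    (hB.isBrownianReal k).toIsPreBrownianReal).hasGaussianLaw_eval t).memLp_two

lemma integral_eq_zero (hB : IsStdBrownianMotion B P) (k : Fin n) (t : ℝ≥0) :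
    ∫ ω, B t ω k ∂P = 0 :=
  (hB.isBrownianReal k).integral_eval t

lemma isGaussianProcess_noise (hB : IsStdBrownianMotion B P) (σ : Matrix (Fin n) (Fin n) ℝ) :
    IsGaussianProcess (fun (p : Fin n × ℝ≥0) ω =>
      Matrix.toEuclideanCLM (𝕜 := ℝ) σ (B p.2 ω) p.1) P := by
  have h := isGaussianProcess_of_iIndepFun (X := fun (k : Fin n) t ω => B t ω k)
    (fun k => IsPreBrownianReal.isGaussianProcess (hB.isBrownianReal k).toIsPreBrownianReal)
    hB.iIndepFun
  refine IsGaussianProcess.of_isGaussianProcess h fun p =>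
    ⟨Finset.univ.image fun k => (k, p.2),
      ∑ k, σ p.1 k • ContinuousLinearMap.proj (R := ℝ) (φ := fun _ => ℝ)
        ⟨(k, p.2), Finset.mem_image_of_mem _ (Finset.mem_univ k)⟩, ?_⟩
  intro ω
  simp [toEuclideanCLM_apply_coord]

lemma memLp_two_noise (hB : IsStdBrownianMotion B P) (σ : Matrix (Fin n) (Fin n) ℝ) (i : Fin n)
    (t : ℝ≥0) : MemLp (fun ω => Matrix.toEuclideanCLM (𝕜 := ℝ) σ (B t ω) i) 2 P :=
  ((hB.isGaussianProcess_noise σ).hasGaussianLaw_eval (i, t)).memLp_two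

variable [IsProbabilityMeasure P]

lemma integral_mul (hB : IsStdBrownianMotion B P) (k l : Fin n) (s t : ℝ≥0) :
    ∫ ω, B s ω k * B t ω l ∂P = if k = l then min (s : ℝ) t else 0 := by
  split_ifs with hkl
  · subst hkl
    have h := (hB.isBrownianReal k).covariance_fun_eval s t
    rw [covariance_eq_sub (hB.memLp_two k s) (hB.memLp_two k t), hB.integral_eq_zero k s, zero_mul,
      sub_zero] at h
    simpa using h
  · have h : IndepFun (fun ω => B s ω k) (fun ω => B t ω l) P :=
      (hB.iIndepFun.indepFun hkl).comp (measurable_pi_apply s) (measurable_pi_apply t)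
    rw [h.integral_fun_mul_eq_mul_integral (hB.memLp_two k s).1 (hB.memLp_two l t).1,
      hB.integral_eq_zero, zero_mul]

lemma integral_noise_mul_noise (hB : IsStdBrownianMotion B P) (σ : Matrix (Fin n) (Fin n) ℝ)
    (i j : Fin n) (s t : ℝ≥0) :
    ∫ ω, Matrix.toEuclideanCLM (𝕜 := ℝ) σ (B s ω) i * Matrix.toEuclideanCLM (𝕜 := ℝ) σ (B t ω) j ∂P
      = (σ * σ.transpose) i j * min (s : ℝ) t := by
  have h : ∀ ω, Matrix.toEuclideanCLM (𝕜 := ℝ) σ (B s ω) i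
      * Matrix.toEuclideanCLM (𝕜 := ℝ) σ (B t ω) j
      = ∑ k, ∑ l, σ i k * σ j l * (B s ω k * B t ω l) := fun ω => by
    rw [toEuclideanCLM_apply_coord, toEuclideanCLM_apply_coord, Finset.sum_mul_sum]
    exact Finset.sum_congr rfl fun k _ => Finset.sum_congr rfl fun l _ => by ring
  have hi : ∀ k l, Integrable (fun ω => σ i k * σ j l * (B s ω k * B t ω l)) P := fun k l =>
    ((hB.memLp_two k s).integrable_mul (hB.memLp_two l t)).const_mul _
  simp only [h]
  rw [integral_finsetSum _ fun k _ => integrable_finsetSum _ fun l _ => hi k l]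
  simp only [integral_finsetSum _ fun l _ => hi _ l, integral_const_mul, hB.integral_mul]
  simp [Matrix.mul_apply, Finset.sum_mul]

lemma integral_noise (hB : IsStdBrownianMotion B P) (σ : Matrix (Fin n) (Fin n) ℝ)
    (i : Fin n) (t : ℝ≥0) : ∫ ω, Matrix.toEuclideanCLM (𝕜 := ℝ) σ (B t ω) i ∂P = 0 := by
  simp only [toEuclideanCLM_apply_coord]
  rw [integral_finsetSum _ fun k _ => ((hB.memLp_two k t).integrable (by norm_num)).const_mul _]
  simp [integral_const_mul, hB.integral_eq_zero]

/-- Brownian noise is continuous in `L²`, as the squared norm of an increment is proportional to its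
length. -/
lemma continuous_toLp_noise (hB : IsStdBrownianMotion B P) (σ : Matrix (Fin n) (Fin n) ℝ)
    (i : Fin n) : Continuous fun t : ℝ => (hB.memLp_two_noise σ i t.toNNReal).toLp := by
  rw [continuous_iff_continuousAt]
  intro t
  rw [ContinuousAt, tendsto_iff_norm_sub_tendsto_zero]
  have h : ∀ s : ℝ, ‖(hB.memLp_two_noise σ i s.toNNReal).toLp
      - (hB.memLp_two_noise σ i t.toNNReal).toLp‖
      = √((σ * σ.transpose) i i * (s.toNNReal + t.toNNReal
        - 2 * min (s.toNNReal : ℝ) t.toNNReal)) := by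
    intro s
    rw [eq_comm, ← Real.sqrt_sq (norm_nonneg _), ← real_inner_self_eq_norm_sq]
    congr 1
    rw [inner_sub_left, inner_sub_right, inner_sub_right]
    simp only [inner_toLp_toLp_two, hB.integral_noise_mul_noise, min_self]
    rw [min_comm (t.toNNReal : ℝ)]
    ring
  simp only [h]
  have hc : Continuous fun s : ℝ => √((σ * σ.transpose) i i * (s.toNNReal + t.toNNReal
        - 2 * min (s.toNNReal : ℝ) t.toNNReal)) := by fun_prop
  have := hc.tendsto t
  simpa [← two_mul] using this

lemma integral_mul_noise (hB : IsStdBrownianMotion B P) (σ : Matrix (Fin n) (Fin n) ℝ)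
    {X : Ω → EuclideanSpace ℝ (Fin n)} (hX : Measurable X)
    (hindep : IndepFun X (fun ω t => B t ω) P) (i j : Fin n) (t : ℝ≥0) :
    ∫ ω, X ω i * Matrix.toEuclideanCLM (𝕜 := ℝ) σ (B t ω) j ∂P = 0 := by
  have h : IndepFun (fun ω => X ω i) (fun ω => Matrix.toEuclideanCLM (𝕜 := ℝ) σ (B t ω) j) P :=
    hindep.comp (φ := fun x : EuclideanSpace ℝ (Fin n) => x i)
      (ψ := fun b : ℝ≥0 → EuclideanSpace ℝ (Fin n) => Matrix.toEuclideanCLM (𝕜 := ℝ) σ (b t) j)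
      (by fun_prop) (by fun_prop)
  rw [h.integral_fun_mul_eq_mul_integral (Measurable.aestronglyMeasurable (by fun_prop))
    (hB.memLp_two_noise σ j t).1, hB.integral_noise, mul_zero]

lemma integral_norm_noise_sq (hB : IsStdBrownianMotion B P) (σ : Matrix (Fin n) (Fin n) ℝ)
    (t : ℝ≥0) : Integrable (fun ω => ‖Matrix.toEuclideanCLM (𝕜 := ℝ) σ (B t ω)‖ ^ 2) P ∧
      ∫ ω, ‖Matrix.toEuclideanCLM (𝕜 := ℝ) σ (B t ω)‖ ^ 2 ∂P = (σ * σ.transpose).trace * t := by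
  have hi : ∀ i, Integrable (fun ω => Matrix.toEuclideanCLM (𝕜 := ℝ) σ (B t ω) i ^ 2) P := fun i =>
    (hB.memLp_two_noise σ i t).integrable_sq
  simp only [EuclideanSpace.real_norm_sq_eq]
  refine ⟨integrable_finsetSum _ fun i _ => hi i, ?_⟩
  rw [integral_finsetSum _ fun i _ => hi i]
  simp only [sq, hB.integral_noise_mul_noise, min_self, Matrix.trace, Matrix.diag_apply,
    Finset.sum_mul]

end IsStdBrownianMotion

/-! ### The stochastic differential equation as an equation in `L²` -/

section LinearSDE

variable {n : ℕ} {Ω : Type*} [MeasurableSpace Ω] {P : Measure Ω} [IsProbabilityMeasure P]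

/-- A solution of the linear stochastic differential equation with square integrable initial value
is square integrable, and its coordinates solve the equation in `L²`. The exceptional null set is
removed by setting the processes to `0` on it, and `max t 0` extends the coefficients continuously
to negative times. -/
lemma IsLinearSDESolution.exists_isLinearIntegralSolution {A : ℝ → Matrix (Fin n) (Fin n) ℝ}
    (hA : ∀ i j, ContinuousOn (fun t => A t i j) (Ici (0 : ℝ))) {σ : Matrix (Fin n) (Fin n) ℝ}
    {B Z : ℝ≥0 → Ω → EuclideanSpace ℝ (Fin n)} (hB : IsStdBrownianMotion B P)
    (hZ : IsLinearSDESolution A σ B Z P) (hZ0 : Integrable (fun ω => ‖Z 0 ω‖ ^ 2) P) :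
    ∃ hZ2 : ∀ (i : Fin n) (t : ℝ≥0), MemLp (fun ω => Z t ω i) 2 P,
      IsLinearIntegralSolution (fun t => A (max t 0))
        (fun i (t : ℝ) => (hZ2 i t.toNNReal).toLp)
        (fun i (t : ℝ) => (hB.memLp_two_noise σ i t.toNNReal).toLp) := by
  have hA' : ∀ i j, Continuous fun t => A (max t 0) i j := fun i j =>
    (hA i j).comp_continuous (by fun_prop) fun t => mem_Ici.2 (le_max_right _ _)
  -- Outside a measurable null set `N` all pathwise properties hold simultaneously.
  have hgood : ∀ᵐ ω ∂P, (Continuous fun t => Z t ω) ∧ (∀ i, Continuous fun t => B t ω i) ∧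
      (∀ i, B 0 ω i = 0) ∧ ∀ t : ℝ≥0, Z t ω = Z 0 ω
        + (∫ s in (0 : ℝ)..t, Matrix.toEuclideanCLM (𝕜 := ℝ) (A s) (Z s.toNNReal ω))
        + Matrix.toEuclideanCLM (𝕜 := ℝ) σ (B t ω - B 0 ω) := by
    have h1 : ∀ᵐ ω ∂P, ∀ i, Continuous fun t => B t ω i :=
      ae_all_iff.2 fun i => (hB.isBrownianReal i).cont
    have h2 : ∀ᵐ ω ∂P, ∀ i, B 0 ω i = 0 :=
      ae_all_iff.2 fun i => (hB.isBrownianReal i).eval_zero_ae_eq_zero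
    filter_upwards [hZ.continuous_paths, h1, h2, hZ.integral_eq] with ω h3 h4 h5 h6
    exact ⟨h3, h4, h5, h6⟩
  obtain ⟨N, hNsub, hNm, hN0⟩ := exists_measurable_superset_of_null (ae_iff.1 hgood)
  have hG : ∀ ω ∈ Nᶜ, _ := fun ω (hω : ω ∈ Nᶜ) => not_not.1 fun h => hω (hNsub h)
  have hGae : ∀ᵐ ω ∂P, ω ∈ Nᶜ := measure_eq_zero_iff_ae_notMem.1 hN0
  let Y : ℝ → Ω → EuclideanSpace ℝ (Fin n) := fun t => Nᶜ.indicator (Z t.toNNReal)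
  let W : ℝ → Ω → EuclideanSpace ℝ (Fin n) := fun t =>
    Nᶜ.indicator fun ω => Matrix.toEuclideanCLM (𝕜 := ℝ) σ (B t.toNNReal ω)
  have hYm : ∀ t, Measurable (Y t) := fun t => (hZ.measurable _).indicator hNm.compl
  have hWm : ∀ t, Measurable (W t) := fun t =>
    Measurable.indicator (by have := hB.measurable t.toNNReal; fun_prop) hNm.compl
  have hYae : ∀ t, Y t =ᵐ[P] Z t.toNNReal := fun t => by
    filter_upwards [hGae] with ω hω using indicator_of_mem hω _
  have hWae : ∀ t, W t =ᵐ[P] fun ω => Matrix.toEuclideanCLM (𝕜 := ℝ) σ (B t.toNNReal ω) :=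
    fun t => by filter_upwards [hGae] with ω hω using indicator_of_mem hω _
  have hYc : ∀ ω, Continuous fun t => Y t ω := fun ω => by
    by_cases hω : ω ∈ Nᶜ
    · simp only [Y, indicator_of_mem hω]
      exact (hG ω hω).1.comp continuous_real_toNNReal
    · simp only [Y, indicator_of_notMem hω]
      exact continuous_const
  have hWc : ∀ ω, Continuous fun t => W t ω := fun ω => by
    by_cases hω : ω ∈ Nᶜ
    · simp only [W, indicator_of_mem hω]
      have h1 : Continuous fun t : ℝ≥0 => B t ω :=
        (PiLp.continuous_toLp 2 _).comp (continuous_pi (hG ω hω).2.1)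
      exact (Matrix.toEuclideanCLM (𝕜 := ℝ) σ).continuous.comp (h1.comp continuous_real_toNNReal)
    · simp only [W, indicator_of_notMem hω]
      exact continuous_const
  have heq : ∀ ω, ∀ t, 0 ≤ t → Y t ω = Y 0 ω
      + (∫ s in (0 : ℝ)..t, Matrix.toEuclideanCLM (𝕜 := ℝ) (A (max s 0)) (Y s ω)) + W t ω := by
    intro ω t ht
    by_cases hω : ω ∈ Nᶜ
    · obtain ⟨-, -, hB0, h⟩ := hG ω hω
      have hB0' : B 0 ω = 0 := by ext i; simpa using hB0 i
      have h1 := h t.toNNReal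
      rw [hB0', sub_zero, Real.coe_toNNReal t ht] at h1
      simp only [Y, W, indicator_of_mem hω, Real.toNNReal_zero]
      rw [h1]
      congr 2
      refine intervalIntegral.integral_congr fun s hs => ?_
      rw [uIcc_of_le ht] at hs
      simp only [max_eq_left hs.1]
    · simp [Y, W, indicator_of_notMem hω]
  have hWint : ∀ t : ℝ, 0 ≤ t → Integrable (fun ω => ‖W t ω‖ ^ 2) P ∧
      ∫ ω, ‖W t ω‖ ^ 2 ∂P = (σ * σ.transpose).trace * t := fun t ht => by
    have h1 : (fun ω => ‖W t ω‖ ^ 2)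
        =ᵐ[P] fun ω => ‖Matrix.toEuclideanCLM (𝕜 := ℝ) σ (B t.toNNReal ω)‖ ^ 2 :=
      (hWae t).fun_comp fun x => ‖x‖ ^ 2
    have h2 := hB.integral_norm_noise_sq σ t.toNNReal
    rw [Real.coe_toNNReal t ht] at h2
    exact ⟨h2.1.congr h1.symm, (integral_congr_ae h1).trans h2.2⟩
  have hY0 : Integrable (fun ω => ‖Y 0 ω‖ ^ 2) P := by
    refine hZ0.congr ?_
    filter_upwards [hYae 0] with ω hω
    rw [hω, Real.toNNReal_zero]
  have hYb : ∀ T : ℝ, ∃ C, ∀ t ∈ Icc 0 T,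
      Integrable (fun ω => ‖Y t ω‖ ^ 2) P ∧ ∫ ω, ‖Y t ω‖ ^ 2 ∂P ≤ C := fun T => by
    obtain ⟨K, hK⟩ := isCompact_Icc.exists_bound_of_continuousOn (s := Icc 0 T)
      (continuous_toEuclideanCLM_comp hA').continuousOn
    refine exists_integral_norm_sq_le hK hYm hWm hYc hWc (fun ω t ht => heq ω t ht.1) hY0
      (fun t ht => (hWint t ht.1).1) (C := |(σ * σ.transpose).trace| * T) fun t ht => ?_
    rw [(hWint t ht.1).2]
    exact mul_le_mul (le_abs_self _) ht.2 ht.1 (abs_nonneg _)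
  have hYmax : ∀ t, Y (max t 0) = Y t := fun t => by
    have : (max t 0).toNNReal = t.toNNReal := by
      rcases le_total t 0 with h | h <;> simp [h, Real.toNNReal_of_nonpos]
    simp only [Y, this]
  have hY2 : ∀ i t, MemLp (fun ω => Y t ω i) 2 P := fun i t => by
    obtain ⟨C, hC⟩ := hYb (max t 0)
    rw [← hYmax t]
    exact memLp_two_coord_of_integrable_norm_sq (hYm _)
      (hC (max t 0) ⟨le_max_right _ _, le_rfl⟩).1 i
  have hYi : ∀ i t, (fun ω => Y t ω i) =ᵐ[P] fun ω => Z t.toNNReal ω i := fun i t =>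
    (hYae t).fun_comp fun x => x i
  have hWi : ∀ i t, (fun ω => W t ω i)
      =ᵐ[P] fun ω => Matrix.toEuclideanCLM (𝕜 := ℝ) σ (B t.toNNReal ω) i := fun i t =>
    (hWae t).fun_comp fun x => x i
  have hW2 : ∀ i t, MemLp (fun ω => W t ω i) 2 P := fun i t =>
    (memLp_congr_ae (hWi i t)).2 (hB.memLp_two_noise σ i t.toNNReal)
  have hZ2 : ∀ (i : Fin n) (t : ℝ≥0), MemLp (fun ω => Z t ω i) 2 P := fun i t => by
    simpa using (memLp_congr_ae (hYi i t)).1 (hY2 i t)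
  have eW : ∀ i t, (hW2 i t).toLp = (hB.memLp_two_noise σ i t.toNNReal).toLp := fun i t =>
    MemLp.toLp_congr _ _ (hWi i t)
  have eY : ∀ i t, (hY2 i t).toLp = (hZ2 i t.toNNReal).toLp := fun i t =>
    MemLp.toLp_congr _ _ (hYi i t)
  refine ⟨hZ2, ?_⟩
  have := isLinearIntegralSolution_toLp hA' hYm hYc hYmax heq hYb hY2 hW2 fun i => by
    simpa only [eW] using hB.continuous_toLp_noise σ i
  simpa only [eW, eY] using this

end LinearSDE

/-! ### Gaussian laws on Euclidean space -/

section GaussianLaw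

variable {n : ℕ} {Ω : Type*} [MeasurableSpace Ω] {P : Measure Ω} [IsProbabilityMeasure P]

lemma covarianceBilin_map_eq_covarianceMatrix {X : Ω → EuclideanSpace ℝ (Fin n)}
    (hX2 : ∀ i, MemLp (fun ω => X ω i) 2 P) (x y : EuclideanSpace ℝ (Fin n)) :
    covarianceBilin (P.map X) x y = x.ofLp ⬝ᵥ Matrix.mulVec (covarianceMatrix X P) y.ofLp := by
  have h := covarianceBilin_apply_pi hX2 x y
  rw [show (fun ω => WithLp.toLp 2 fun i => X ω i) = X from rfl] at h
  rw [h]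
  simp only [dotProduct, Matrix.mulVec, Finset.mul_sum, covarianceMatrix, Matrix.of_apply]
  exact Finset.sum_congr rfl fun i _ => Finset.sum_congr rfl fun j _ => by ring

lemma posSemidef_covarianceMatrix {X : Ω → EuclideanSpace ℝ (Fin n)}
    (hX2 : ∀ i, MemLp (fun ω => X ω i) 2 P) : (covarianceMatrix X P).PosSemidef := by
  refine Matrix.PosSemidef.of_dotProduct_mulVec_nonneg ?_ fun x => ?_
  · ext i j
    simp [covarianceMatrix, covariance_comm]
  · have := covarianceBilin_self_nonneg (μ := P.map X) (WithLp.toLp 2 x)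
    rw [covarianceBilin_map_eq_covarianceMatrix hX2] at this
    simpa using this

/-- A Gaussian measure is determined by its mean and its covariance. -/
lemma hasLaw_multivariateGaussian {X : Ω → EuclideanSpace ℝ (Fin n)} (hX : HasGaussianLaw X P) :
    HasLaw X (multivariateGaussian (meanVector X P) (covarianceMatrix X P)) P := by
  have hX2 : ∀ i, MemLp (fun ω => X ω i) 2 P := fun i => hX.memLp_two.eval_piLp i
  refine ⟨hX.aemeasurable, ?_⟩
  have := hX.isGaussian_map
  refine IsGaussian.ext ?_ ?_
  · rw [integral_map hX.aemeasurable (by fun_prop)]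
    simp [meanVector]
  · ext x y
    rw [covarianceBilin_map_eq_covarianceMatrix hX2,
      covarianceBilin_multivariateGaussian (posSemidef_covarianceMatrix hX2)]

end GaussianLaw

theorem mainTheorem1 {n : ℕ} {Ω : Type*} [MeasurableSpace Ω] (P : Measure Ω)
    [IsProbabilityMeasure P]
    (b : EuclideanSpace ℝ (Fin n) → EuclideanSpace ℝ (Fin n))
    (D : Matrix (Fin n) (Fin n) ℝ) (hD : D.PosSemidef)
    (xhat : ℝ → EuclideanSpace ℝ (Fin n))
    (hxhat : ∀ t ∈ Ici (0 : ℝ), HasDerivWithinAt xhat (b (xhat t)) (Ici 0) t)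
    (hb : ∀ t ∈ Ici (0 : ℝ), DifferentiableAt ℝ b (xhat t))
    (hA : ∀ i j, ContinuousOn (fun t => jacobianMatrix b (xhat t) i j) (Ici (0 : ℝ)))
    (B : ℝ≥0 → Ω → EuclideanSpace ℝ (Fin n)) (hB : IsStdBrownianMotion B P)
    (Z : ℝ≥0 → Ω → EuclideanSpace ℝ (Fin n))
    (hZ : IsLinearSDESolution (fun t => jacobianMatrix b (xhat t)) (psdSqrt ((2 : ℝ) • D)) B Z P)
    (μ₀ : EuclideanSpace ℝ (Fin n)) (S₀ : Matrix (Fin n) (Fin n) ℝ) (hS₀ : S₀.PosSemidef)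
    (hZ₀ : HasLaw (Z 0) (multivariateGaussian μ₀ S₀) P)
    (hindep : IndepFun (Z 0) (fun (ω : Ω) (t : ℝ≥0) => B t ω) P) :
    (∀ t : ℝ≥0, (covarianceMatrix (Z t) P).PosSemidef ∧
      HasLaw (Z t) (multivariateGaussian (meanVector (Z t) P) (covarianceMatrix (Z t) P)) P) ∧
    meanVector (Z 0) P = μ₀ ∧
    covarianceMatrix (Z 0) P = S₀ ∧
    (∀ t : ℝ≥0, HasDerivWithinAt (fun s : ℝ => meanVector (Z s.toNNReal) P)
      (Matrix.toEuclideanCLM (𝕜 := ℝ) (jacobianMatrix b (xhat t)) (meanVector (Z t) P))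
      (Ici 0) t) ∧
    (∀ t : ℝ≥0, ∀ i j,
      HasDerivWithinAt (fun s : ℝ => covarianceMatrix (Z s.toNNReal) P i j)
        ((jacobianMatrix b (xhat t) * covarianceMatrix (Z t) P
          + covarianceMatrix (Z t) P * (jacobianMatrix b (xhat t)).transpose
          + (2 : ℝ) • D) i j)
        (Ici 0) t) := by
  set σ := psdSqrt ((2 : ℝ) • D) with hσ
  have hq : σ * σ.transpose = (2 : ℝ) • D := by
    have h1 : σ.transpose = σ := by
      simpa using (psdSqrt_posSemidef ((2 : ℝ) • D)).isHermitian.eq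
    rw [h1, hσ, psdSqrt_mul_self (hD.smul (by norm_num))]
  have hG0 : HasGaussianLaw (Z 0) P := hZ₀.hasGaussianLaw
  obtain ⟨hZ2, hsol⟩ := hZ.exists_isLinearIntegralSolution hA hB hG0.memLp_two.norm.integrable_sq
  have hww : ∀ i j, ∀ s : ℝ, 0 ≤ s → ∀ t : ℝ, 0 ≤ t →
      inner ℝ (hB.memLp_two_noise σ i s.toNNReal).toLp (hB.memLp_two_noise σ j t.toNNReal).toLp
        = ((2 : ℝ) • D) i j * min s t := fun i j s hs t ht => by
    rw [inner_toLp_toLp_two, hB.integral_noise_mul_noise, hq, Real.coe_toNNReal s hs,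
      Real.coe_toNNReal t ht]
  have hzw : ∀ i j, ∀ t : ℝ, 0 ≤ t → inner ℝ (hZ2 i (0 : ℝ).toNNReal).toLp
      (hB.memLp_two_noise σ j t.toNNReal).toLp = 0 := fun i j t _ => by
    rw [inner_toLp_toLp_two]
    simpa using hB.integral_mul_noise σ (hZ.measurable 0) hindep i j t.toNNReal
  have hmean : ∀ (t : ℝ≥0) i, meanVector (Z t) P i = inner ℝ (indicatorConstLp 2 MeasurableSet.univ
      (measure_ne_top P _) (1 : ℝ)) (hZ2 i t).toLp := fun t i => by
    rw [← integral_eq_inner_one, integral_congr_ae (hZ2 i t).coeFn_toLp]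
    exact eval_integral_piLp (fun i => (hZ2 i t).integrable (by norm_num)) i
  have hcov : ∀ (t : ℝ≥0) i j, covarianceMatrix (Z t) P i j
      = inner ℝ (hZ2 i t).toLp (hZ2 j t).toLp - meanVector (Z t) P i * meanVector (Z t) P j := by
    intro t i j
    rw [inner_toLp_toLp_two, hmean, hmean, ← integral_eq_inner_one, ← integral_eq_inner_one,
      integral_congr_ae (hZ2 i t).coeFn_toLp, integral_congr_ae (hZ2 j t).coeFn_toLp]
    exact covariance_eq_sub (hZ2 i t) (hZ2 j t)
  have hmean' : ∀ (t : ℝ≥0) i, HasDerivWithinAt (fun s : ℝ => meanVector (Z s.toNNReal) P i)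
      (∑ k, jacobianMatrix b (xhat t) i k * meanVector (Z t) P k) (Ici 0) t := fun t i => by
    have := hsol.hasDerivWithinAt_inner_const (v := indicatorConstLp 2 MeasurableSet.univ
      (measure_ne_top P _) (1 : ℝ)) (fun i s _ => by
        rw [← integral_eq_inner_one, integral_congr_ae (MemLp.coeFn_toLp _), hB.integral_noise])
      i t.coe_nonneg
    simpa only [← hmean, max_eq_left t.coe_nonneg, Real.toNNReal_coe] using this
  refine ⟨fun t => ⟨posSemidef_covarianceMatrix fun i => hZ2 i t, ?_⟩, ?_, ?_, fun t => ?_,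
    fun t i j => ?_⟩
  · -- A vector orthogonal to the initial value and to the noise is orthogonal to the solution.
    have hX := isGaussianProcess_sumElim (X := fun (i : Fin n) ω => Z 0 ω i)
      (Y := fun (p : Fin n × ℝ≥0) ω => Matrix.toEuclideanCLM (𝕜 := ℝ) σ (B p.2 ω) p.1)
      ⟨fun I => hG0.map (ContinuousLinearMap.pi fun i : I => EuclideanSpace.proj (𝕜 := ℝ) i.1)⟩
      (hB.isGaussianProcess_noise σ)
      (hindep.comp (φ := fun (x : EuclideanSpace ℝ (Fin n)) i => x i)
        (ψ := fun (β : ℝ≥0 → EuclideanSpace ℝ (Fin n)) (p : Fin n × ℝ≥0) =>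
          Matrix.toEuclideanCLM (𝕜 := ℝ) σ (β p.2) p.1) (by fun_prop) (by fun_prop))
    refine hasLaw_multivariateGaussian (hasGaussianLaw_euclideanSpace_of_mem hX (hZ.measurable t)
      (fun i => hZ2 i t) fun i => ?_)
    rw [Submodule.mem_orthogonal]
    intro v hv
    have hv' := fun p => Submodule.inner_left_of_mem_orthogonal
      (Submodule.subset_span (mem_range_self p)) hv
    have hv0 : ∀ i, inner ℝ v (hZ2 i 0).toLp = 0 := fun i => hv' (.inl i)
    have := hsol.inner_eq_zero (v := v) (T := t)
      (fun i => by simpa only [Real.toNNReal_zero] using hv0 i)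
      (fun i s _ => hv' (.inr (i, s.toNNReal))) i ⟨t.coe_nonneg, le_rfl⟩
    simpa only [Real.toNNReal_coe] using this
  · rw [meanVector, hZ₀.integral_eq, integral_id_multivariateGaussian]
  · ext i j
    rw [← covariance_eval_multivariateGaussian (μ := μ₀) hS₀ i j]
    exact hZ₀.covariance_fun_comp (f := fun x => x i) (g := fun x => x j)
      (Measurable.aemeasurable (by fun_prop)) (Measurable.aemeasurable (by fun_prop))
  · rw [hasDerivWithinAt_iff_hasFDerivWithinAt, hasFDerivWithinAt_euclidean]
    intro i
    refine (hmean' t i).hasFDerivWithinAt.congr_fderiv ?_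
    ext
    simp [toEuclideanCLM_apply_coord]
  · -- Subtract the product of the means from the second moments.
    have h1 := hsol.hasDerivWithinAt_inner hww hzw i j t.coe_nonneg
    have h2 := (hmean' t i).mul (hmean' t j)
    simp only [max_eq_left t.coe_nonneg, Real.toNNReal_coe] at h1
    have h3 := h1.sub h2
    refine (h3.congr (fun s _ => hcov s.toNNReal i j) (hcov _ i j)).congr_deriv ?_
    simp only [Matrix.add_apply, Matrix.mul_apply, Matrix.transpose_apply, hcov,
      Real.toNNReal_coe, mul_sub, sub_mul, Finset.sum_sub_distrib, Finset.sum_mul, Finset.mul_sum]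
    have e1 : ∑ k, jacobianMatrix b (xhat t) i k * meanVector (Z t) P k * meanVector (Z t) P j
        = ∑ k, jacobianMatrix b (xhat t) i k * (meanVector (Z t) P k * meanVector (Z t) P j) :=
      Finset.sum_congr rfl fun k _ => mul_assoc _ _ _
    have e2 : ∑ k, meanVector (Z t) P i * (jacobianMatrix b (xhat t) j k * meanVector (Z t) P k)
        = ∑ k, meanVector (Z t) P i * meanVector (Z t) P k * jacobianMatrix b (xhat t) j k :=
      Finset.sum_congr rfl fun k _ => by ring
    have e3 : ∑ k, jacobianMatrix b (xhat t) j k * inner ℝ (hZ2 i t).toLp (hZ2 k t).toLp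
        = ∑ k, inner ℝ (hZ2 i t).toLp (hZ2 k t).toLp * jacobianMatrix b (xhat t) j k :=
      Finset.sum_congr rfl fun k _ => mul_comm _ _
    rw [e1, e2, e3]
    ring
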